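/- Let $\mathbb T$ be the circle group with normalized Lebesgue (Haar) measure $m$, and let $\mu$ be an adapted Borel probability measure on $\mathbb T$, i.e. the closed subgroup generated by the support of $\mu$ is $\mathbb T$. Let $\mu^k$ denote the $k$-th convolution power of $\mu$, and call $\mu^k$ non-singular if it is not singular with respect to $m$. Let $P_\mu f(x)=\int f(xy)\,\mu(dy)$ be the convolution operator, with transition probability $P_\mu(x,A)=\mu(Ax^{-1})$ and $n$-step transition probability $P_\mu^{(n)}(x,A)$; its dual $P_\mu^*$ (the adjoint in $L_2(\mathbb T,m)$) is $P_{\check\mu}$ with $\check\mu(A)=\mu(A^{-1})$. Let $Ef=\int f\,dm$, and let $\|\cdot\|_p$ be the operator norm on the complex space $L_p(\mathbb T,m)$. A transition probability $P$ on $\mathbb T$ with invariant probability $m$ satisfies Doeblin's condition if there are $n\ge 1$ and $\varepsilon\in(0,1)$ such that, for every Borel set $A$, $m(A)<1-\varepsilon$ implies $\sup_x P^{(n)}(x,A)\le\varepsilon$. Then: (i) $P_\mu$ satisfies Doeblin's condition if and only if $\mu^k$ is non-singular for some $k\ge 1$. (ii) $P_\mu$ satisfies Doeblin's condition if and only if $P_\mu^*$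 does; that is, $\|P_\mu^n-E\|_\infty\to 0$ if and only if $\|P_\mu^n-E\|_1\to 0$. Here $P_\mu$ satisfies Doeblin's condition if and only if $\|P_\mu^n-E\|_\infty\to0$, and $P_\mu^*$ satisfies it if and only if $\|P_\mu^n-E\|_1\to0$. -/

import Mathlib

open MeasureTheory ProbabilityTheory Filter Topology
open scoped ENNReal

namespace CircleWalk

noncomputable section

/-- The circle group carries its Borel `σ`-algebra. -/
instance instMeasurableSpaceCircle : MeasurableSpace Circle := borel Circle

instance instBorelSpaceCircle : BorelSpace Circle := ⟨rfl⟩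

/-- Normalized Lebesgue (Haar) measure `m` on the circle group. -/
def leb : Measure Circle := Measure.haarMeasure ⊤

instance instProbLeb : IsProbabilityMeasure leb := ⟨Measure.haarMeasure_self⟩

instance instHaarLeb : leb.IsHaarMeasure :=
  inferInstanceAs (Measure.haarMeasure (⊤ : TopologicalSpace.PositiveCompacts Circle)).IsHaarMeasure

/-- `μ` is adapted: the closed subgroup generated by its support is the whole circle. -/
def Adapted (μ : Measure Circle) : Prop :=
  (Subgroup.closure μ.support).topologicalClosure = ⊤

/-- Convolution powers `μ^n`, with `μ^0 = δ_1`. -/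
def convPow (μ : Measure Circle) : ℕ → Measure Circle
  | 0 => Measure.dirac 1
  | n + 1 => (convPow μ n).mconv μ

/-- `μ` is non-singular: it is not singular with respect to Lebesgue measure `m`. -/
def NonSingular (μ : Measure Circle) : Prop := ¬ μ.MutuallySingular leb

/-- The reflection `μ̌(A) = μ(A⁻¹)`. -/
def reflect (μ : Measure Circle) : Measure Circle := μ.map (fun y => y⁻¹)

instance instProbReflect (μ : Measure Circle) [IsProbabilityMeasure μ] :
    IsProbabilityMeasure (reflect μ) :=
  Measure.isProbabilityMeasure_map (by fun_prop)

/-- The transition probability `P(x, A) = μ(A x⁻¹) = μ {y | y x ∈ A}` of the random walk. -/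
def walkKernel (μ : Measure Circle) [IsProbabilityMeasure μ] : Kernel Circle Circle where
  toFun x := μ.map (fun y => y * x)
  measurable' := by
    refine Measure.measurable_of_measurable_coe _ fun s hs => ?_
    have h : ∀ x : Circle, (μ.map fun y => y * x) s = μ ((fun y => (x, y)) ⁻¹'
        ((fun p : Circle × Circle => p.2 * p.1) ⁻¹' s)) := fun x => by
      rw [Measure.map_apply (by fun_prop) hs]; rfl
    simp_rw [h]
    exact measurable_measure_prodMk_left ((by fun_prop : Measurable _) hs)

/-- Doeblin's condition for a transition probability `κ` with invariant probability `m`: there are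
`n ≥ 1` and `ε ∈ (0,1)` such that `m(A) < 1 - ε` implies `sup_x κ^(n)(x, A) ≤ ε`. The power `κ ^ n`
is the `n`-step transition probability. -/
def Doeblin {S : Type*} [MeasurableSpace S] (κ : Kernel S S) (m : Measure S) : Prop :=
  ∃ n : ℕ, 1 ≤ n ∧ ∃ ε : ℝ, 0 < ε ∧ ε < 1 ∧
    ∀ A : Set S, MeasurableSet A → m A < ENNReal.ofReal (1 - ε) →
      ⨆ x, (κ ^ n) x A ≤ ENNReal.ofReal ε

/-- Pointwise formula of the convolution operator, `P_μ f (x) = ∫ f (x y) μ(dy)`. -/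
def convFun (μ : Measure Circle) (f : Circle → ℂ) (x : Circle) : ℂ := ∫ y, f (x * y) ∂μ

section
variable {μ : Measure Circle} [IsProbabilityMeasure μ]

lemma measurePreserving_mul : MeasurePreserving (fun z : Circle × Circle => z.1 * z.2)
    (leb.prod μ) leb := by
  refine ⟨by fun_prop, ?_⟩
  ext s hs
  rw [Measure.map_apply (by fun_prop) hs, Measure.prod_apply_symm ((by fun_prop : Measurable _) hs)]
  have : ∀ y : Circle, leb ((fun x => (x, y)) ⁻¹' ((fun z : Circle × Circle => z.1 * z.2) ⁻¹' s))
      = leb s := fun y => measure_preimage_mul_right leb y s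
  simp [this]

lemma ae_ae_mul {q : Circle → Prop} (h : ∀ᵐ x ∂leb, q x) :
    ∀ᵐ x ∂leb, ∀ᵐ y ∂μ, q (x * y) :=
  Measure.ae_ae_of_ae_prod ((measurePreserving_mul (μ := μ)).quasiMeasurePreserving.ae h)

lemma convFun_congr {f g : Circle → ℂ} (h : f =ᵐ[leb] g) : convFun μ f =ᵐ[leb] convFun μ g := by
  filter_upwards [ae_ae_mul (μ := μ) h] with x hx using integral_congr_ae hx

lemma aestronglyMeasurable_convFun {f : Circle → ℂ} (hf : AEStronglyMeasurable f leb) :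
    AEStronglyMeasurable (convFun μ f) leb :=
  (hf.comp_measurePreserving (measurePreserving_mul (μ := μ))).integral_prod_right'

lemma eLpNorm_convFun_le {p : ℝ≥0∞} (hp : 1 ≤ p) {f : Circle → ℂ}
    (hf : AEStronglyMeasurable f leb) : eLpNorm (convFun μ f) p leb ≤ eLpNorm f p leb := by
  have hF := hf.comp_measurePreserving (measurePreserving_mul (μ := μ))
  rcases eq_or_ne p ∞ with rfl | hp'
  · simp only [eLpNorm_exponent_top]
    refine essSup_le_of_ae_le _ ?_
    filter_upwards [ae_ae_mul (μ := μ) (ae_le_eLpNormEssSup (f := f) (μ := leb))] with x hx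
    calc ‖convFun μ f x‖ₑ ≤ ∫⁻ y, ‖f (x * y)‖ₑ ∂μ := enorm_integral_le_lintegral_enorm _
      _ ≤ ∫⁻ _, eLpNormEssSup f leb ∂μ := lintegral_mono_ae hx
      _ = _ := by simp
  · have hp0 : p ≠ 0 := (zero_lt_one.trans_le hp).ne'
    have hpos : 0 < p.toReal := ENNReal.toReal_pos hp0 hp'
    rw [← eLpNorm_comp_measurePreserving hf (measurePreserving_mul (μ := μ)),
      eLpNorm_eq_lintegral_rpow_enorm_toReal hp0 hp', eLpNorm_eq_lintegral_rpow_enorm_toReal hp0 hp']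
    gcongr
    rw [lintegral_prod _ (hF.enorm.pow_const _)]
    refine lintegral_mono_ae ?_
    filter_upwards [hF.prodMk_left] with x hx
    have h1 : ‖convFun μ f x‖ₑ ≤ eLpNorm (fun y => f (x * y)) p μ :=
      calc ‖convFun μ f x‖ₑ ≤ ∫⁻ y, ‖f (x * y)‖ₑ ∂μ := enorm_integral_le_lintegral_enorm _
        _ = eLpNorm (fun y => f (x * y)) 1 μ := eLpNorm_one_eq_lintegral_enorm.symm
        _ ≤ _ := eLpNorm_le_eLpNorm_of_exponent_le hp hx
    calc ‖convFun μ f x‖ₑ ^ p.toReal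
        ≤ (eLpNorm (fun y => f (x * y)) p μ) ^ p.toReal := by gcongr
      _ = _ := by
        rw [eLpNorm_eq_lintegral_rpow_enorm_toReal hp0 hp', ← ENNReal.rpow_mul,
          one_div_mul_cancel hpos.ne', ENNReal.rpow_one]
        rfl

lemma memLp_convFun {p : ℝ≥0∞} (hp : 1 ≤ p) {f : Circle → ℂ} (hf : MemLp f p leb) :
    MemLp (convFun μ f) p leb :=
  ⟨aestronglyMeasurable_convFun hf.1, (eLpNorm_convFun_le hp hf.1).trans_lt hf.2⟩

lemma ae_integrable_mul {f : Circle → ℂ} (hf : Integrable f leb) :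
    ∀ᵐ x ∂leb, Integrable (fun y => f (x * y)) μ :=
  ((measurePreserving_mul (μ := μ)).integrable_comp_of_integrable hf).prod_right_ae

end

/-- The convolution operator `P_μ` as a linear map on the complex space `L_p(m)`. -/
def convLin (μ : Measure Circle) [IsProbabilityMeasure μ] (p : ℝ≥0∞) [hp : Fact (1 ≤ p)] :
    Lp ℂ p leb →ₗ[ℂ] Lp ℂ p leb where
  toFun f := (memLp_convFun (μ := μ) hp.out (Lp.memLp f)).toLp (convFun μ f)
  map_add' f g := by
    rw [← MemLp.toLp_add]
    refine MemLp.toLp_congr _ _ ?_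
    refine (convFun_congr (Lp.coeFn_add f g)).trans ?_
    filter_upwards [ae_integrable_mul (μ := μ) ((Lp.memLp f).integrable hp.out),
      ae_integrable_mul (μ := μ) ((Lp.memLp g).integrable hp.out)] with x h1 h2
    exact integral_add h1 h2
  map_smul' c f := by
    rw [RingHom.id_apply, ← MemLp.toLp_const_smul]
    refine MemLp.toLp_congr _ ((memLp_convFun hp.out (Lp.memLp f)).const_smul c) ?_
    refine (convFun_congr (Lp.coeFn_smul c f)).trans ?_
    exact .of_forall fun x => integral_smul c _

lemma norm_convLin_le (μ : Measure Circle) [IsProbabilityMeasure μ] (p : ℝ≥0∞)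
    [hp : Fact (1 ≤ p)] (f : Lp ℂ p leb) : ‖convLin μ p f‖ ≤ 1 * ‖f‖ := by
  rw [one_mul, Lp.norm_def f]
  have h := memLp_convFun (μ := μ) hp.out (Lp.memLp f)
  refine (Lp.norm_toLp (convFun μ f) h).trans_le ?_
  exact ENNReal.toReal_mono (Lp.eLpNorm_ne_top f) (eLpNorm_convFun_le hp.out (Lp.memLp f).1)

/-- The convolution operator `P_μ` as a bounded operator on the complex space `L_p(m)`,
`1 ≤ p ≤ ∞`: `P_μ f (x) = ∫ f (x y) μ(dy)` for almost every `x`. -/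
def convOp (μ : Measure Circle) [IsProbabilityMeasure μ] (p : ℝ≥0∞) [Fact (1 ≤ p)] :
    Lp ℂ p leb →L[ℂ] Lp ℂ p leb :=
  (convLin μ p).mkContinuous 1 (norm_convLin_le μ p)

lemma convOp_coeFn (μ : Measure Circle) [IsProbabilityMeasure μ] (p : ℝ≥0∞) [hp : Fact (1 ≤ p)]
    (f : Lp ℂ p leb) : convOp μ p f =ᵐ[leb] fun x => ∫ y, f (x * y) ∂μ :=
  MemLp.coeFn_toLp (memLp_convFun (μ := μ) hp.out (Lp.memLp f))

/-- The integral `f ↦ ∫ f dm` as a bounded functional on `L_p(m)`. -/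
def integralFunctional (p : ℝ≥0∞) [hp : Fact (1 ≤ p)] : Lp ℂ p leb →L[ℂ] ℂ :=
  LinearMap.mkContinuous
    { toFun := fun f => ∫ x, f x ∂leb
      map_add' := fun f g => by
        rw [integral_congr_ae (Lp.coeFn_add f g)]
        exact integral_add ((Lp.memLp f).integrable hp.out) ((Lp.memLp g).integrable hp.out)
      map_smul' := fun c f => by
        rw [integral_congr_ae (Lp.coeFn_smul c f)]
        exact integral_smul c _ }
    1 fun f => by
      rw [one_mul, Lp.norm_def]
      refine (ENNReal.ofReal_le_iff_le_toReal (Lp.eLpNorm_ne_top f)).1 ?_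
      simp only [LinearMap.coe_mk, AddHom.coe_mk, ofReal_norm]
      refine (enorm_integral_le_lintegral_enorm _).trans ?_
      rw [← eLpNorm_one_eq_lintegral_enorm]
      exact eLpNorm_le_eLpNorm_of_exponent_le hp.out (Lp.memLp f).1

/-- The expectation operator `E f = ∫ f dm` (a constant function) on `L_p(m)`. -/
def expOp (p : ℝ≥0∞) [Fact (1 ≤ p)] : Lp ℂ p leb →L[ℂ] Lp ℂ p leb :=
  (Lp.constL p leb ℂ).comp (integralFunctional p)

lemma measurePreserving_div {μ : Measure Circle} [IsProbabilityMeasure μ] :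
    MeasurePreserving (fun z : Circle × Circle => z.1 * z.2⁻¹) (leb.prod μ) leb :=
  (measurePreserving_mul (μ := reflect μ)).comp
    ((MeasurePreserving.id leb).prod ⟨measurable_inv, rfl⟩)

/-- The adjoint of `P_μ` on `L_2(m)` is the convolution operator of the reflected measure, so the
transition probability of the dual Markov operator `P_μ^*` is `walkKernel (reflect μ)`. -/
theorem adjoint_convOp (μ : Measure Circle) [IsProbabilityMeasure μ] :
    ContinuousLinearMap.adjoint (convOp μ 2) = convOp (reflect μ) 2 := by
  symm
  rw [ContinuousLinearMap.eq_adjoint_iff]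
  intro f g
  rw [L2.inner_def, L2.inner_def]
  have hf1 : MemLp (fun z : Circle × Circle => f z.1) 2 (leb.prod μ) :=
    (Lp.memLp f).comp_measurePreserving measurePreserving_fst
  have hg1 : MemLp (fun z : Circle × Circle => g z.1) 2 (leb.prod μ) :=
    (Lp.memLp g).comp_measurePreserving measurePreserving_fst
  have hf2 : MemLp (fun z : Circle × Circle => f (z.1 * z.2⁻¹)) 2 (leb.prod μ) :=
    (Lp.memLp f).comp_measurePreserving measurePreserving_div
  have hg2 : MemLp (fun z : Circle × Circle => g (z.1 * z.2)) 2 (leb.prod μ) :=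
    (Lp.memLp g).comp_measurePreserving measurePreserving_mul
  have i1 : Integrable (fun z : Circle × Circle => g z.1 * star (f (z.1 * z.2⁻¹)))
      (leb.prod μ) := hg1.integrable_mul hf2.star
  have i2 : Integrable (fun z : Circle × Circle => g (z.1 * z.2) * star (f z.1))
      (leb.prod μ) := hg2.integrable_mul hf1.star
  have e1 : ∫ x, inner ℂ (convOp (reflect μ) 2 f x) (g x) ∂leb
      = ∫ x, ∫ y, g x * star (f (x * y⁻¹)) ∂μ ∂leb := by
    refine integral_congr_ae ?_
    have hm : AEStronglyMeasurable (fun z : Circle × Circle => f (z.1 * z.2))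
        (leb.prod (reflect μ)) :=
      ((Lp.memLp f).comp_measurePreserving measurePreserving_mul).1
    filter_upwards [convOp_coeFn (reflect μ) 2 f, hm.prodMk_left] with x hx hmx
    rw [hx, integral_const_mul]
    have h3 : ∫ y, f (x * y) ∂(reflect μ) = ∫ y, f (x * y⁻¹) ∂μ :=
      integral_map (by fun_prop) hmx
    rw [h3, RCLike.inner_apply]
    congr 1
    exact (integral_conj (f := fun y => f (x * y⁻¹))).symm
  have e2 : ∫ x, inner ℂ (f x) (convOp μ 2 g x) ∂leb
      = ∫ x, ∫ y, g (x * y) * star (f x) ∂μ ∂leb := by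
    refine integral_congr_ae ?_
    filter_upwards [convOp_coeFn μ 2 g] with x hx
    rw [hx, integral_mul_const, RCLike.inner_apply]
    rfl
  rw [e1, e2]
  refine (integral_integral_swap i1).trans (Eq.trans ?_ (integral_integral_swap i2).symm)
  congr 1
  ext y
  rw [← integral_mul_right_eq_self _ y]
  simp

end

end CircleWalk

/-! Everything passes through one condition: some power `μ^k` is non-singular. It is stable under
reflection, because inversion preserves `leb` and commutes with convolution powers. It remains to
match it with Doeblin's condition and with norm convergence in L_∞ and in L_1.

Doeblin's condition: translation invariance of `leb` removes the supremum over x. If the absolutely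
continuous part of a probability measure has mass a > 0, sets of small Lebesgue measure receive at
most 1 - a/2 (`NonSingular.exists_le_of_measure_lt`); a singular measure gives full mass to a null
set.

Norm convergence: by a Steinhaus argument, a non-singular measure convolved with itself dominates a
multiple of `leb` on an open set. Further powers move this set to 1 and spread it over the circle,
so that some `μ^n` is (1 - d) `leb` + d ρ with d < 1. Since E absorbs convolution operators,
P_μ^(nj) - E has norm at most 2 d^j on every L_p. Conversely, testing on indicators shows that a
singular ν keeps P_ν - E at norm at least 1, both in L_∞ and in L_1. -/

namespace CircleWalk

open scoped Pointwise

/-! ### Convolution powers, reflection and n-step transitions -/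

instance isProbabilityMeasure_convPow (μ : Measure Circle) [IsProbabilityMeasure μ] (n : ℕ) :
    IsProbabilityMeasure (convPow μ n) := by
  induction n with
  | zero => exact inferInstanceAs (IsProbabilityMeasure (Measure.dirac 1))
  | succ n ih => exact inferInstanceAs (IsProbabilityMeasure ((convPow μ n) ∗ₘ μ))

lemma convPow_add (μ : Measure Circle) [IsProbabilityMeasure μ] (m n : ℕ) :
    convPow μ (m + n) = (convPow μ m) ∗ₘ (convPow μ n) := by
  induction n with
  | zero => exact (Measure.mconv_dirac_one _).symm
  | succ n ih =>
    change (convPow μ (m + n)) ∗ₘ μ = (convPow μ m) ∗ₘ ((convPow μ n) ∗ₘ μ)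
    rw [ih, Measure.mconv_assoc]

lemma reflect_apply (μ : Measure Circle) {s : Set Circle} (hs : MeasurableSet s) :
    reflect μ s = μ s⁻¹ :=
  Measure.map_apply measurable_inv hs

lemma reflect_reflect (μ : Measure Circle) : reflect (reflect μ) = μ := by
  ext s hs
  rw [reflect_apply _ hs, reflect_apply _ hs.inv, inv_inv]

/-- The circle is abelian, so inversion is a homomorphism and pushes convolutions to convolutions.
-/
lemma convPow_reflect (μ : Measure Circle) [IsProbabilityMeasure μ] (n : ℕ) :
    convPow (reflect μ) n = reflect (convPow μ n) := by
  induction n with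
  | zero =>
    change Measure.dirac 1 = (Measure.dirac 1).map _
    rw [Measure.map_dirac' measurable_inv, inv_one]
  | succ n ih =>
    change (convPow (reflect μ) n) ∗ₘ (reflect μ) = reflect ((convPow μ n) ∗ₘ μ)
    rw [ih]
    exact (Measure.map_mconv_monoidHom (invMonoidHom : Circle →* Circle)
      measurable_inv).symm

lemma nonSingular_reflect {μ : Measure Circle} (h : NonSingular μ) : NonSingular (reflect μ) := by
  intro hs
  refine h ⟨hs.nullSet⁻¹, hs.measurableSet_nullSet.inv, ?_, ?_⟩
  · rw [← reflect_apply μ hs.measurableSet_nullSet]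
    exact hs.measure_nullSet
  · rw [← Set.compl_inv, Measure.measure_inv]
    exact hs.measure_compl_nullSet

lemma exists_nonSingular_reflect {μ : Measure Circle} [IsProbabilityMeasure μ]
    (h : ∃ k, 1 ≤ k ∧ NonSingular (convPow μ k)) :
    ∃ k, 1 ≤ k ∧ NonSingular (convPow (reflect μ) k) := by
  obtain ⟨k, hk, hs⟩ := h
  exact ⟨k, hk, by rw [convPow_reflect]; exact nonSingular_reflect hs⟩

lemma walkKernel_pow_apply (μ : Measure Circle) [IsProbabilityMeasure μ] (n : ℕ) (x : Circle)
    {s : Set Circle} (hs : MeasurableSet s) :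
    (walkKernel μ ^ n) x s = convPow μ n ((fun y => y * x) ⁻¹' s) := by
  induction n generalizing x with
  | zero =>
    change Kernel.id x s = Measure.dirac 1 _
    rw [Kernel.id_apply, Measure.dirac_apply' _ hs,
      Measure.dirac_apply' _ (hs.preimage (by fun_prop))]
    have : (1 : Circle) ∈ (fun y => y * x) ⁻¹' s ↔ x ∈ s := by rw [Set.mem_preimage, one_mul]
    by_cases hx : x ∈ s
    · rw [Set.indicator_of_mem hx, Set.indicator_of_mem (this.2 hx)]; rfl
    · rw [Set.indicator_of_notMem hx, Set.indicator_of_notMem (this.not.2 hx)]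
  | succ n ih =>
    rw [add_comm, Kernel.pow_add_apply_eq_lintegral _ _ _ _ hs, pow_one, add_comm]
    change ∫⁻ b, _ ∂(μ.map fun y => y * x) = ((convPow μ n) ∗ₘ μ) _
    -- The kernel power integrates the first step outermost, while `convPow` adds its new factor on
    -- the right; commutativity reconciles the two.
    rw [lintegral_map (Kernel.measurable_coe _ hs) (by fun_prop), Measure.mconv_comm,
      ← lintegral_indicator_one (hs.preimage (by fun_prop)),
      Measure.lintegral_mconv (measurable_one.indicator (hs.preimage (by fun_prop)))]
    refine lintegral_congr fun y => ?_
    have h : MeasurableSet ((fun z : Circle => z * (y * x)) ⁻¹' s) := hs.preimage (by fun_prop)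
    rw [ih, ← lintegral_indicator_one h]
    refine lintegral_congr fun z => ?_
    have hz : z ∈ (fun z => z * (y * x)) ⁻¹' s ↔ y * z ∈ (fun w => w * x) ⁻¹' s := by
      rw [Set.mem_preimage, Set.mem_preimage, mul_comm y z, mul_assoc]
    by_cases hx : z ∈ (fun z => z * (y * x)) ⁻¹' s
    · rw [Set.indicator_of_mem hx, Set.indicator_of_mem (hz.1 hx)]; rfl
    · rw [Set.indicator_of_notMem hx, Set.indicator_of_notMem (hz.not.1 hx)]

/-! ### Doeblin's condition and non-singularity -/

lemma exists_nonSingular_of_doeblin {μ : Measure Circle} [IsProbabilityMeasure μ]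
    (h : Doeblin (walkKernel μ) leb) : ∃ k, 1 ≤ k ∧ NonSingular (convPow μ k) := by
  obtain ⟨n, hn, ε, h0, h1, H⟩ := h
  refine ⟨n, hn, fun hs => ?_⟩
  have hA := hs.measurableSet_nullSet.compl
  have h2 := (le_iSup (fun x => (walkKernel μ ^ n) x hs.nullSetᶜ) 1).trans
    (H _ hA (by rw [hs.measure_compl_nullSet]; simpa using h1))
  rw [walkKernel_pow_apply _ _ _ hA] at h2
  simp only [mul_one, Set.preimage_id'] at h2
  rw [(prob_compl_eq_one_iff hs.measurableSet_nullSet).2 hs.measure_nullSet] at h2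
  exact absurd h2 (by simpa using h1)

/-- Absolute continuity of the integral of the density: small sets take at most half of its mass a,
and the singular part adds at most 1 - a. -/
lemma NonSingular.exists_le_of_measure_lt {ν : Measure Circle} [IsProbabilityMeasure ν]
    (h : NonSingular ν) : ∃ ε : ℝ, 0 < ε ∧ ε < 1 ∧ ∀ A : Set Circle, MeasurableSet A →
      leb A < ENNReal.ofReal (1 - ε) → ν A ≤ ENNReal.ofReal ε := by
  set f := ν.rnDeriv leb
  have hdec : ν.singularPart leb + leb.withDensity f = ν := Measure.singularPart_add_rnDeriv ν leb
  have hfin : ∫⁻ x, f x ∂leb ≠ ∞ := (Measure.lintegral_rnDeriv_lt_top ν leb).ne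
  have htot : ν.singularPart leb Set.univ + ∫⁻ x, f x ∂leb = 1 := by
    have := congrArg (fun m : Measure Circle => m Set.univ) hdec
    simpa using this
  have hpos : ∫⁻ x, f x ∂leb ≠ 0 := fun h0 => h <| by
    rw [← Measure.withDensity_rnDeriv_eq_zero, ← Measure.measure_univ_eq_zero]
    simpa using h0
  set a := (∫⁻ x, f x ∂leb).toReal
  have ha : ∫⁻ x, f x ∂leb = ENNReal.ofReal a := (ENNReal.ofReal_toReal hfin).symm
  have ha0 : 0 < a := ENNReal.toReal_pos hpos hfin
  have ha1 : a ≤ 1 := by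
    have : ∫⁻ x, f x ∂leb ≤ 1 := htot ▸ le_add_self
    exact ENNReal.toReal_le_of_le_ofReal zero_le_one (by simpa using this)
  have hs : ν.singularPart leb Set.univ = ENNReal.ofReal (1 - a) := by
    rw [ENNReal.ofReal_sub _ ha0.le, ← ha, ENNReal.ofReal_one, ← htot,
      ENNReal.add_sub_cancel_right hfin]
  obtain ⟨δ, hδ, H⟩ := exists_pos_setLIntegral_lt_of_measure_lt hfin
    (ε := ENNReal.ofReal (a / 2)) (by simpa using ha0)
  obtain ⟨d, hd0, hd⟩ : ∃ d : ℝ, 0 < d ∧ ENNReal.ofReal d ≤ δ := by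
    rcases eq_or_ne δ ∞ with rfl | h
    · exact ⟨1, one_pos, le_top⟩
    · exact ⟨δ.toReal, ENNReal.toReal_pos hδ.ne' h, ENNReal.ofReal_toReal_le⟩
  -- A single ε serves as threshold and as bound, so 1 - ε = η must be below both d and a/2.
  set η := min d (a / 2)
  have hη0 : 0 < η := lt_min hd0 (by linarith)
  have hηa : η ≤ a / 2 := min_le_right _ _
  refine ⟨1 - η, by linarith, by linarith, fun A hA hm => ?_⟩
  rw [sub_sub_cancel] at hm
  have h1 : ∫⁻ x in A, f x ∂leb ≤ ENNReal.ofReal (a / 2) :=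
    (H A (hm.trans_le ((ENNReal.ofReal_le_ofReal (min_le_left _ _)).trans hd))).le
  calc ν A = ν.singularPart leb A + ∫⁻ x in A, f x ∂leb := by
        conv_lhs => rw [← hdec]
        rw [Measure.add_apply, withDensity_apply _ hA]
    _ ≤ ENNReal.ofReal (1 - a) + ENNReal.ofReal (a / 2) :=
        add_le_add ((measure_mono (Set.subset_univ A)).trans_eq hs) h1
    _ = ENNReal.ofReal (1 - a + a / 2) := (ENNReal.ofReal_add (by linarith) (by linarith)).symm
    _ ≤ _ := ENNReal.ofReal_le_ofReal (by linarith)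

lemma doeblin_of_nonSingular {μ : Measure Circle} [IsProbabilityMeasure μ] {k : ℕ} (hk : 1 ≤ k)
    (h : NonSingular (convPow μ k)) : Doeblin (walkKernel μ) leb := by
  obtain ⟨ε, h0, h1, H⟩ := h.exists_le_of_measure_lt
  refine ⟨k, hk, ε, h0, h1, fun A hA hm => iSup_le fun x => ?_⟩
  rw [walkKernel_pow_apply _ _ _ hA]
  exact H _ (hA.preimage (by fun_prop)) (by rwa [measure_preimage_mul_right])

theorem doeblin_iff_exists_nonSingular (μ : Measure Circle) [IsProbabilityMeasure μ] :
    Doeblin (walkKernel μ) leb ↔ ∃ k, 1 ≤ k ∧ NonSingular (convPow μ k) :=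
  ⟨exists_nonSingular_of_doeblin, fun ⟨_, hk, h⟩ => doeblin_of_nonSingular hk h⟩

/-! ### Lebesgue lower bounds and their growth under convolution -/

lemma mconv_mono {ν ν' ρ ρ' : Measure Circle} [SFinite ρ'] (h : ν ≤ ν') (h' : ρ ≤ ρ') :
    ν ∗ₘ ρ ≤ ν' ∗ₘ ρ' :=
  Measure.map_mono (Measure.prod_mono h h') (by fun_prop)

lemma indicator_mlconvolution (V W : Set Circle) (hV : MeasurableSet V) (hW : MeasurableSet W)
    (z : Circle) : ((V.indicator 1 : Circle → ℝ≥0∞) ⋆ₘₗ[leb] (W.indicator 1)) z =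
      leb (V ∩ {v | v⁻¹ * z ∈ W}) := by
  have hm : MeasurableSet {v : Circle | v⁻¹ * z ∈ W} :=
    hW.preimage (by fun_prop : Measurable fun v : Circle => v⁻¹ * z)
  rw [mlconvolution_def, ← lintegral_indicator_one (hV.inter hm)]
  refine lintegral_congr fun v => ?_
  by_cases h1 : v ∈ V <;> by_cases h2 : v⁻¹ * z ∈ W <;> simp [h1, h2, Set.indicator]

lemma restrict_mconv_restrict {V W : Set Circle} (hV : MeasurableSet V) (hW : MeasurableSet W) :
    (leb.restrict V) ∗ₘ (leb.restrict W) =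
      leb.withDensity fun z => leb (V ∩ {v | v⁻¹ * z ∈ W}) := by
  rw [← withDensity_indicator_one hV, ← withDensity_indicator_one hW,
    mconv_withDensity_eq_mlconvolution (measurable_one.indicator hV) (measurable_one.indicator hW)]
  congr 1
  ext z
  exact indicator_mlconvolution V W hV hW z

lemma smul_measure_mono {ν ν' : Measure Circle} (c : ℝ≥0∞) (h : ν ≤ ν') : c • ν ≤ c • ν' :=
  Measure.le_iff'.2 fun s => mul_le_mul_right (h s) c

/-- Near `x`, the measure `ν` dominates a positive multiple of Lebesgue measure. -/
def LowerBoundAt (ν : Measure Circle) (x : Circle) : Prop :=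
  ∃ c : ℝ≥0∞, c ≠ 0 ∧ ∃ V ∈ 𝓝 x, c • leb.restrict V ≤ ν

lemma LowerBoundAt.mono {ν ν' : Measure Circle} {x : Circle} (h : LowerBoundAt ν x)
    (hν : ν ≤ ν') : LowerBoundAt ν' x := by
  obtain ⟨c, hc, V, hV, hle⟩ := h
  exact ⟨c, hc, V, hV, hle.trans hν⟩

lemma LowerBoundAt.smul {ν : Measure Circle} {x : Circle} (h : LowerBoundAt ν x)
    {c : ℝ≥0∞} (hc : c ≠ 0) : LowerBoundAt (c • ν) x := by
  obtain ⟨d, hd, V, hV, hle⟩ := h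
  refine ⟨c * d, mul_ne_zero hc hd, V, hV, ?_⟩
  rw [mul_smul]
  exact smul_measure_mono c hle

lemma lowerBoundAt_restrict_mconv {V W : Set Circle} (hV : MeasurableSet V)
    (hW : MeasurableSet W) {x : Circle} {c : ℝ≥0∞} (hc : c ≠ 0)
    (h : ∀ᶠ z in 𝓝 x, c ≤ leb (V ∩ {v | v⁻¹ * z ∈ W})) :
    LowerBoundAt ((leb.restrict V) ∗ₘ (leb.restrict W)) x := by
  obtain ⟨U, hU, hUo, hxU⟩ := eventually_nhds_iff.1 h
  refine ⟨c, hc, U, hUo.mem_nhds hxU, ?_⟩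
  rw [restrict_mconv_restrict hV hW, ← withDensity_indicator_one hUo.measurableSet,
    ← withDensity_smul _ (measurable_one.indicator hUo.measurableSet)]
  refine withDensity_mono (.of_forall fun z => ?_)
  by_cases hz : z ∈ U
  · simpa [hz] using hU z hz
  · simp [hz]

/-- For v near x and z near xy, the point v⁻¹z lies near y; hence the density of the convolution
near xy is at least the measure of a fixed neighbourhood of x. -/
lemma LowerBoundAt.mconv {ν ρ : Measure Circle} [SFinite ν] [SFinite ρ] {x y : Circle}
    (hν : LowerBoundAt ν x) (hρ : LowerBoundAt ρ y) : LowerBoundAt (ν ∗ₘ ρ) (x * y) := by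
  obtain ⟨c, hc, V, hV, hcV⟩ := hν
  obtain ⟨d, hd, W, hW, hdW⟩ := hρ
  obtain ⟨V', hV'V, hV'o, hxV'⟩ := mem_nhds_iff.1 hV
  obtain ⟨W', hW'W, hW'o, hyW'⟩ := mem_nhds_iff.1 hW
  have hcont : Tendsto (fun p : Circle × Circle => p.2⁻¹ * p.1) (𝓝 (x * y) ×ˢ 𝓝 x) (𝓝 y) := by
    rw [← nhds_prod_eq]
    exact (by fun_prop : Continuous fun p : Circle × Circle => p.2⁻¹ * p.1).tendsto' _ _ (by simp)
  obtain ⟨A, hA, B, hB, hAB⟩ := mem_prod_iff.1 (hcont (hW'o.mem_nhds hyW'))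
  have hpos : leb (V' ∩ B) ≠ 0 :=
    (Measure.measure_pos_of_mem_nhds leb (inter_mem (hV'o.mem_nhds hxV') hB)).ne'
  have key : LowerBoundAt ((leb.restrict V') ∗ₘ (leb.restrict W')) (x * y) := by
    refine lowerBoundAt_restrict_mconv hV'o.measurableSet hW'o.measurableSet hpos ?_
    filter_upwards [hA] with z hz
    exact measure_mono fun v hv => ⟨hv.1, hAB (Set.mk_mem_prod hz hv.2)⟩
  refine ((key.smul hd).smul hc).mono ?_
  rw [← Measure.mconv_smul_right, ← Measure.mconv_smul_left]
  refine mconv_mono ?_ ?_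
  · exact (smul_measure_mono c (Measure.restrict_mono_set _ hV'V)).trans hcV
  · exact (smul_measure_mono d (Measure.restrict_mono_set _ hW'W)).trans hdW

/-- Steinhaus: the density of the convolution has integral `leb E` squared, so it is positive at
some z. Continuity of translation on a compact set K of positive measure keeps it at least half of
`leb K` near z. -/
lemma exists_lowerBoundAt_restrict_mconv {E : Set Circle} (hE : MeasurableSet E)
    (h0 : leb E ≠ 0) : ∃ x, LowerBoundAt ((leb.restrict E) ∗ₘ (leb.restrict E)) x := by
  obtain ⟨z, hz⟩ : ∃ z, leb (E ∩ {v | v⁻¹ * z ∈ E}) ≠ 0 := by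
    by_contra! h
    have h1 := congrArg (fun m : Measure Circle => m Set.univ) (restrict_mconv_restrict hE hE)
    simp only [h] at h1
    rw [Measure.mconv, Measure.map_apply (by fun_prop) .univ, Set.preimage_univ,
      ← Set.univ_prod_univ, Measure.prod_prod] at h1
    simp [h0] at h1
  have hF : MeasurableSet (E ∩ {v | v⁻¹ * z ∈ E}) :=
    hE.inter (hE.preimage (by fun_prop : Measurable fun v : Circle => v⁻¹ * z))
  obtain ⟨K, hKF, hK, hK0⟩ := hF.exists_lt_isCompact (pos_iff_ne_zero.2 hz)
  have hKt : leb K ≠ ∞ := measure_ne_top _ _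
  refine ⟨z, lowerBoundAt_restrict_mconv hE hE (c := leb K / 2) (by simpa using hK0.ne') ?_⟩
  have hev := eventually_nhds_one_measure_smul_sdiff_lt (μ := leb) hK hK.isClosed
    (ε := (leb K / 2).toNNReal)
    (by simp [ENNReal.toNNReal_eq_zero_iff, hK0.ne', hKt])
  have ht : Tendsto (fun w : Circle => w * z⁻¹) (𝓝 z) (𝓝 1) :=
    (by fun_prop : Continuous fun w : Circle => w * z⁻¹).tendsto' _ _ (by simp)
  filter_upwards [ht.eventually hev] with w hw
  rw [ENNReal.coe_toNNReal (ENNReal.div_ne_top hKt two_ne_zero)] at hw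
  set g := w * z⁻¹ with hg
  -- With v = gk and g = wz⁻¹, one has v⁻¹w = k⁻¹z, which lies in E because k is in K.
  have hsub : g • K ∩ K ⊆ E ∩ {v | v⁻¹ * w ∈ E} := by
    rintro v ⟨hv, hvK⟩
    obtain ⟨k, hk, rfl⟩ := hv
    refine ⟨(hKF hvK).1, ?_⟩
    have := (hKF hk).2
    simp only [Set.mem_ofPred_eq, smul_eq_mul, hg] at this ⊢
    convert this using 1
    simp [mul_comm, mul_left_comm]
  refine le_trans ?_ (measure_mono hsub)
  have h1 : leb K ≤ leb (g • K \ K) + leb (g • K ∩ K) := by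
    rw [← measure_smul leb g K, add_comm, measure_inter_add_sdiff _ hK.measurableSet]
  have h2 : leb K / 2 + leb K / 2 ≤ leb K / 2 + leb (g • K ∩ K) := by
    rw [ENNReal.add_halves]
    exact h1.trans (by gcongr)
  exact (ENNReal.add_le_add_iff_left (ENNReal.div_ne_top hKt two_ne_zero)).1 h2

/-- The density is not a.e. zero, so it exceeds some 1/n on a set of positive measure. -/
lemma NonSingular.exists_restrict_le {ν : Measure Circle} [IsProbabilityMeasure ν]
    (h : NonSingular ν) : ∃ E : Set Circle, MeasurableSet E ∧ leb E ≠ 0 ∧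
      ∃ c : ℝ≥0∞, c ≠ 0 ∧ c • leb.restrict E ≤ ν := by
  have hm : Measurable (ν.rnDeriv leb) := Measure.measurable_rnDeriv _ _
  have hne : ¬ ν.rnDeriv leb =ᵐ[leb] 0 := fun h0 => h ((Measure.rnDeriv_eq_zero _ _).1 h0)
  have hpos : leb (⋃ n : ℕ, {x | (n : ℝ≥0∞)⁻¹ < ν.rnDeriv leb x}) ≠ 0 := by
    refine fun h0 => hne ?_
    rw [Filter.EventuallyEq, ae_iff]
    refine measure_mono_null (fun x hx => ?_) h0
    obtain ⟨n, hn⟩ := ENNReal.exists_inv_nat_lt (a := ν.rnDeriv leb x) hx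
    exact Set.mem_iUnion.2 ⟨n, hn⟩
  obtain ⟨n, hn⟩ := exists_measure_pos_of_not_measure_iUnion_null hpos
  have hE : MeasurableSet {x | (n : ℝ≥0∞)⁻¹ < ν.rnDeriv leb x} :=
    measurableSet_lt measurable_const hm
  refine ⟨_, hE, hn.ne', (n : ℝ≥0∞)⁻¹, by simp, ?_⟩
  refine le_trans ?_ (Measure.withDensity_rnDeriv_le ν leb)
  rw [← withDensity_indicator_one hE, ← withDensity_smul _ (measurable_one.indicator hE)]
  refine withDensity_mono (.of_forall fun x => ?_)
  by_cases hx : (n : ℝ≥0∞)⁻¹ < ν.rnDeriv leb x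
  · simpa [Set.indicator, hx] using hx.le
  · simp [Set.indicator, hx]

lemma NonSingular.exists_lowerBoundAt {ν : Measure Circle} [IsProbabilityMeasure ν]
    (h : NonSingular ν) : ∃ x, LowerBoundAt (ν ∗ₘ ν) x := by
  obtain ⟨E, hE, h0, c, hc, hle⟩ := h.exists_restrict_le
  obtain ⟨x, hx⟩ := exists_lowerBoundAt_restrict_mconv hE h0
  refine ⟨x, ((hx.smul hc).smul hc).mono ?_⟩
  rw [← Measure.mconv_smul_right, ← Measure.mconv_smul_left]
  exact mconv_mono hle hle

lemma isOpen_setOf_lowerBoundAt (ν : Measure Circle) : IsOpen {x | LowerBoundAt ν x} := by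
  refine isOpen_iff_mem_nhds.2 fun x ⟨c, hc, V, hV, hle⟩ => ?_
  filter_upwards [eventually_mem_nhds_iff.2 hV] with y hy
  exact ⟨c, hc, V, hy, hle⟩

lemma LowerBoundAt.pow {μ : Measure Circle} [IsProbabilityMeasure μ] {n : ℕ} {x : Circle}
    (h : LowerBoundAt (convPow μ n) x) (j : ℕ) :
    LowerBoundAt (convPow μ (n * (j + 1))) (x ^ (j + 1)) := by
  induction j with
  | zero => simpa using h
  | succ j ih =>
    rw [pow_succ, mul_add_one n, convPow_add]
    exact ih.mconv h

/-- The points with a lower bound form an open set, which therefore contains a root of unity;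
raising it to a power that kills it gives 1. -/
lemma LowerBoundAt.exists_one {μ : Measure Circle} [IsProbabilityMeasure μ] {n : ℕ} (hn : 1 ≤ n)
    {x : Circle} (h : LowerBoundAt (convPow μ n) x) :
    ∃ m, 1 ≤ m ∧ LowerBoundAt (convPow μ m) 1 := by
  have ho : IsOpen {t : ℝ | LowerBoundAt (convPow μ n) (Circle.exp (2 * Real.pi * t))} :=
    (isOpen_setOf_lowerBoundAt _).preimage (by fun_prop)
  have hne : {t : ℝ | LowerBoundAt (convPow μ n) (Circle.exp (2 * Real.pi * t))}.Nonempty := by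
    refine ⟨Complex.arg x / (2 * Real.pi), ?_⟩
    rw [Set.mem_ofPred_eq, mul_div_cancel₀ _ Real.two_pi_pos.ne', Circle.exp_arg]
    exact h
  obtain ⟨_, ht, q, rfl⟩ := (Rat.denseRange_cast (𝕜 := ℝ)).inter_open_nonempty _ ho hne
  have hq : Circle.exp (2 * Real.pi * (q : ℝ)) ^ q.den = 1 := by
    rw [← Circle.exp_nsmul, Circle.exp_eq_one]
    refine ⟨q.num, ?_⟩
    have : (q : ℝ) * q.den = q.num := by exact_mod_cast Rat.mul_den_eq_num q
    rw [nsmul_eq_mul, ← this]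
    ring
  obtain ⟨j, hj⟩ := Nat.exists_eq_add_of_le' q.den_pos
  refine ⟨n * (j + 1), Nat.mul_pos hn j.succ_pos, ?_⟩
  rw [← hq, hj]
  exact LowerBoundAt.pow ht j

/-- The lower bound holds on an arc of angles below δ. Once j > π/δ, every x has a (j+1)-th root in
that arc. -/
lemma LowerBoundAt.exists_forall {μ : Measure Circle} [IsProbabilityMeasure μ] {n : ℕ}
    (hn : 1 ≤ n) (h : LowerBoundAt (convPow μ n) 1) :
    ∃ m, 1 ≤ m ∧ ∀ x, LowerBoundAt (convPow μ m) x := by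
  have ho : IsOpen {t : ℝ | LowerBoundAt (convPow μ n) (Circle.exp t)} :=
    (isOpen_setOf_lowerBoundAt _).preimage (by fun_prop)
  obtain ⟨δ, hδ, hball⟩ := Metric.isOpen_iff.1 ho 0 (by simpa using h)
  obtain ⟨j, hj⟩ := exists_nat_gt (Real.pi / δ)
  refine ⟨n * (j + 1), Nat.mul_pos hn j.succ_pos, fun x => ?_⟩
  have hx : Circle.exp (Complex.arg x / (j + 1)) ^ (j + 1) = x := by
    rw [← Circle.exp_nsmul, nsmul_eq_mul]
    push_cast
    rw [mul_div_cancel₀ _ (by positivity), Circle.exp_arg]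
  rw [← hx]
  refine LowerBoundAt.pow (hball ?_) j
  rw [mem_ball_zero_iff, Real.norm_eq_abs, abs_div, abs_of_pos (by positivity : (0 : ℝ) < j + 1),
    div_lt_iff₀ (by positivity)]
  rw [div_lt_iff₀ hδ] at hj
  nlinarith [Complex.abs_arg_le_pi (x : ℂ)]

/-- Compactness: the local bounds are glued over a finite cover. -/
lemma exists_smul_leb_le {ν : Measure Circle} (h : ∀ x, LowerBoundAt ν x) :
    ∃ c : ℝ≥0∞, c ≠ 0 ∧ c • leb ≤ ν := by
  suffices H : ∃ c : ℝ≥0∞, c ≠ 0 ∧ c • leb.restrict Set.univ ≤ ν by simpa using H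
  refine isCompact_univ.induction_on (p := fun s => ∃ c : ℝ≥0∞, c ≠ 0 ∧ c • leb.restrict s ≤ ν)
    ⟨1, one_ne_zero, by simp [Measure.zero_le]⟩ ?_ ?_ ?_
  · rintro s t hst ⟨c, hc, hle⟩
    exact ⟨c, hc, (smul_measure_mono c (Measure.restrict_mono_set _ hst)).trans hle⟩
  · rintro s t ⟨c, hc, hcs⟩ ⟨d, hd, hdt⟩
    -- The pieces may overlap; the factor 1/2 pays for using `ν A` twice.
    refine ⟨min c d / 2, by simp [hc, hd], Measure.le_iff'.2 fun A => ?_⟩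
    have h1 : min c d * leb.restrict s A ≤ ν A :=
      (mul_le_mul_left (min_le_left c d) _).trans (hcs A)
    have h2 : min c d * leb.restrict t A ≤ ν A :=
      (mul_le_mul_left (min_le_right c d) _).trans (hdt A)
    calc min c d / 2 * leb.restrict (s ∪ t) A
        ≤ min c d / 2 * (leb.restrict s A + leb.restrict t A) := by
          gcongr
          exact Measure.restrict_union_le s t A
      _ = (min c d * leb.restrict s A + min c d * leb.restrict t A) / 2 := by
          rw [div_eq_mul_inv, div_eq_mul_inv]; ring
      _ ≤ (ν A + ν A) / 2 := by gcongr
      _ = ν A := by rw [ENNReal.add_div, ENNReal.add_halves]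
  · intro x _
    obtain ⟨c, hc, V, hV, hle⟩ := h x
    exact ⟨V, mem_nhdsWithin_of_mem_nhds hV, c, hc, hle⟩

theorem exists_smul_leb_le_convPow {μ : Measure Circle} [IsProbabilityMeasure μ]
    (h : ∃ k, 1 ≤ k ∧ NonSingular (convPow μ k)) :
    ∃ n, 1 ≤ n ∧ ∃ c : ℝ≥0∞, c ≠ 0 ∧ c • leb ≤ convPow μ n := by
  obtain ⟨k, hk, hs⟩ := h
  obtain ⟨x, hx⟩ := hs.exists_lowerBoundAt
  rw [← convPow_add] at hx
  obtain ⟨m, hm, h1⟩ := hx.exists_one (by omega)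
  obtain ⟨n, hn, h2⟩ := h1.exists_forall hm
  exact ⟨n, hn, exists_smul_leb_le h2⟩

/-! ### Convolution operators and geometric convergence -/

section
variable (p : ℝ≥0∞) [hp : Fact (1 ≤ p)]

lemma convOp_mul_convOp (μ ν : Measure Circle) [IsProbabilityMeasure μ] [IsProbabilityMeasure ν] :
    convOp μ p * convOp ν p = convOp (μ ∗ₘ ν) p := by
  ext1 f
  refine Lp.ext ?_
  refine (convOp_coeFn μ p (convOp ν p f)).trans ?_
  refine (convFun_congr (μ := μ) (convOp_coeFn ν p f)).trans ?_
  filter_upwards [convOp_coeFn (μ ∗ₘ ν) p f,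
    ae_integrable_mul (μ := μ ∗ₘ ν) ((Lp.memLp f).integrable hp.out)] with x hx hi
  rw [hx, integral_mconv hi]
  simp only [convFun, mul_assoc]

lemma convOp_dirac_one : convOp (Measure.dirac 1) p = 1 := by
  ext1 f
  refine Lp.ext ?_
  filter_upwards [convOp_coeFn (Measure.dirac 1) p f] with x hx
  rw [hx, integral_dirac, mul_one]
  rfl

lemma convOp_pow (μ : Measure Circle) [IsProbabilityMeasure μ] (n : ℕ) :
    convOp μ p ^ n = convOp (convPow μ n) p := by
  induction n with
  | zero => exact (convOp_dirac_one p).symm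
  | succ n ih => rw [pow_succ, ih, convOp_mul_convOp]; rfl

lemma expOp_coeFn (f : Lp ℂ p leb) : expOp p f =ᵐ[leb] fun _ => ∫ x, f x ∂leb :=
  Lp.coeFn_const p leb _

lemma convOp_leb : convOp leb p = expOp p := by
  ext1 f
  refine Lp.ext ?_
  filter_upwards [convOp_coeFn leb p f, expOp_coeFn p f] with x hx hx'
  rw [hx, hx', integral_mul_left_eq_self]

lemma mconv_leb (μ : Measure Circle) [IsProbabilityMeasure μ] : μ ∗ₘ leb = leb := by
  ext s hs
  rw [← lintegral_indicator_one hs, Measure.lintegral_mconv (measurable_one.indicator hs)]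
  simp [lintegral_mul_left_eq_self, lintegral_indicator_one hs]

lemma convOp_congr {μ ν : Measure Circle} [IsProbabilityMeasure μ] [IsProbabilityMeasure ν]
    (h : μ = ν) : convOp μ p = convOp ν p := by
  subst h
  rfl

lemma convOp_mul_expOp (μ : Measure Circle) [IsProbabilityMeasure μ] :
    convOp μ p * expOp p = expOp p := by
  rw [← convOp_leb, convOp_mul_convOp, convOp_congr p (mconv_leb μ)]

lemma expOp_mul_convOp (μ : Measure Circle) [IsProbabilityMeasure μ] :
    expOp p * convOp μ p = expOp p := by
  rw [← convOp_leb, convOp_mul_convOp,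
    convOp_congr p ((Measure.mconv_comm leb μ).trans (mconv_leb μ))]

lemma norm_convOp_le (μ : Measure Circle) [IsProbabilityMeasure μ] : ‖convOp μ p‖ ≤ 1 :=
  LinearMap.mkContinuous_norm_le _ zero_le_one _

lemma convOp_add_smul {ν ρ : Measure Circle} [IsProbabilityMeasure ν] [IsProbabilityMeasure ρ]
    {c d : ℝ≥0∞} (h : ν = c • leb + d • ρ) :
    convOp ν p = (c.toReal : ℂ) • expOp p + (d.toReal : ℂ) • convOp ρ p := by
  have hc : c ≤ 1 := by
    have := congrArg (fun m : Measure Circle => m Set.univ) h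
    simp only [Measure.add_apply, Measure.smul_apply, measure_univ, smul_eq_mul, mul_one] at this
    exact this ▸ le_self_add
  have hd : d ≤ 1 := by
    have := congrArg (fun m : Measure Circle => m Set.univ) h
    simp only [Measure.add_apply, Measure.smul_apply, measure_univ, smul_eq_mul, mul_one] at this
    exact this ▸ le_add_self
  rw [← convOp_leb]
  ext1 f
  refine Lp.ext ?_
  change _ =ᵐ[leb] ⇑((c.toReal : ℂ) • convOp leb p f + (d.toReal : ℂ) • convOp ρ p f)
  have hf := (Lp.memLp f).integrable hp.out
  filter_upwards [convOp_coeFn ν p f, convOp_coeFn leb p f, convOp_coeFn ρ p f,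
    Lp.coeFn_add ((c.toReal : ℂ) • convOp leb p f) ((d.toReal : ℂ) • convOp ρ p f),
    Lp.coeFn_smul (c.toReal : ℂ) (convOp leb p f), Lp.coeFn_smul (d.toReal : ℂ) (convOp ρ p f),
    ae_integrable_mul (μ := leb) hf, ae_integrable_mul (μ := ρ) hf] with x h1 h2 h3 h4 h5 h6 i1 i2
  rw [h4, Pi.add_apply, h5, h6, Pi.smul_apply, Pi.smul_apply, h1, h2, h3, h,
    integral_add_measure (i1.smul_measure (hc.trans_lt ENNReal.one_lt_top).ne)
      (i2.smul_measure (hd.trans_lt ENNReal.one_lt_top).ne),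
    integral_smul_measure, integral_smul_measure]
  simp

lemma exists_eq_smul_leb_add {ν : Measure Circle} [IsProbabilityMeasure ν] {c : ℝ≥0∞}
    (hc : c ≠ 0) (h : c • leb ≤ ν) : ∃ d : ℝ≥0∞, d < 1 ∧ ∃ ρ : Measure Circle,
      IsProbabilityMeasure ρ ∧ ν = (1 - d) • leb + d • ρ := by
  have hc1 : c ≤ 1 := by simpa using h Set.univ
  have hct : c ≠ ∞ := (hc1.trans_lt ENNReal.one_lt_top).ne
  -- Halving c keeps the remaining mass d = 1 - c/2 positive even when c = 1, so the remainder can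
  -- be normalized.
  have hlt : c / 2 < 1 := (ENNReal.half_lt_self hc hct).trans_le hc1
  have hle : (c / 2) • leb ≤ ν :=
    (Measure.le_iff'.2 fun s => mul_le_mul_left ENNReal.half_le_self _).trans h
  have : IsFiniteMeasure ((c / 2) • leb) := isFiniteMeasure_of_le ν hle
  have hadd : ν - (c / 2) • leb + (c / 2) • leb = ν := Measure.sub_add_cancel_of_le hle
  set d := 1 - c / 2 with hd
  have hd0 : d ≠ 0 := (tsub_pos_of_lt hlt).ne'
  have hdt : d ≠ ∞ := (tsub_le_self.trans_lt ENNReal.one_lt_top).ne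
  have huniv : (ν - (c / 2) • leb) Set.univ = d := by
    rw [Measure.sub_apply .univ hle]
    simp [hd]
  refine ⟨d, ENNReal.sub_lt_self ENNReal.one_ne_top one_ne_zero (by simpa using hc),
    d⁻¹ • (ν - (c / 2) • leb), ⟨?_⟩, ?_⟩
  · rw [Measure.smul_apply, huniv, smul_eq_mul, ENNReal.inv_mul_cancel hd0 hdt]
  · rw [smul_smul, ENNReal.mul_inv_cancel hd0 hdt, one_smul, hd,
      ENNReal.sub_sub_cancel ENNReal.one_ne_top hlt.le, add_comm, hadd]

/-- E annihilates P_ν^j - E, so another factor P_ν acts on it as d P_ρ, and P_ρ is a contraction.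
The initial 2 bounds the norm of 1 - E. -/
lemma norm_convOp_pow_sub_expOp_le {ν ρ : Measure Circle} [IsProbabilityMeasure ν]
    [IsProbabilityMeasure ρ] {d : ℝ≥0∞} (h : ν = (1 - d) • leb + d • ρ) (j : ℕ) :
    ‖convOp ν p ^ j - expOp p‖ ≤ d.toReal ^ j * 2 := by
  induction j with
  | zero =>
    rw [pow_zero, pow_zero, one_mul, ← convOp_dirac_one, ← convOp_leb]
    exact (norm_sub_le _ _).trans
      (by linarith [norm_convOp_le p (Measure.dirac 1), norm_convOp_le p leb])
  | succ j ih =>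
    have hE : expOp p * convOp ν p ^ j = expOp p := by rw [convOp_pow, expOp_mul_convOp]
    have hEE : expOp p * expOp p = expOp p :=
      (congrArg (expOp p * ·) (convOp_leb p).symm).trans (expOp_mul_convOp p leb)
    have key : convOp ν p ^ (j + 1) - expOp p
        = (d.toReal : ℂ) • (convOp ρ p * (convOp ν p ^ j - expOp p)) := by
      have h1 : convOp ν p ^ (j + 1) - expOp p
          = convOp ν p * (convOp ν p ^ j - expOp p) := by
        rw [mul_sub, convOp_mul_expOp, pow_succ']
      rw [h1]
      conv_lhs => rw [convOp_add_smul p h]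
      rw [add_mul, smul_mul_assoc, mul_sub (expOp p), smul_mul_assoc]
      have h2 : expOp p * (((1 - d).toReal : ℂ) • expOp p + (d.toReal : ℂ) • convOp ρ p) ^ j
          = expOp p := by rw [← convOp_add_smul p h, hE]
      rw [h2, hEE, sub_self, smul_zero, zero_add, ← convOp_add_smul p h]
    rw [key, norm_smul, pow_succ', mul_assoc, Complex.norm_real, Real.norm_eq_abs,
      abs_of_nonneg ENNReal.toReal_nonneg]
    refine mul_le_mul_of_nonneg_left ?_ ENNReal.toReal_nonneg
    calc ‖convOp ρ p * (convOp ν p ^ j - expOp p)‖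
        ≤ ‖convOp ρ p‖ * ‖convOp ν p ^ j - expOp p‖ := norm_mul_le _ _
      _ ≤ 1 * ‖convOp ν p ^ j - expOp p‖ := by gcongr; exact norm_convOp_le p ρ
      _ ≤ _ := by rwa [one_mul]

/-- Monotonicity makes convergence along the multiples of one n sufficient. -/
lemma antitone_norm_convOp_pow_sub_expOp (μ : Measure Circle) [IsProbabilityMeasure μ] :
    Antitone fun n : ℕ => ‖convOp μ p ^ n - expOp p‖ := by
  refine antitone_nat_of_succ_le fun n => ?_
  have h1 : convOp μ p ^ (n + 1) - expOp p = convOp μ p * (convOp μ p ^ n - expOp p) := by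
    rw [mul_sub, convOp_mul_expOp, pow_succ']
  rw [h1]
  calc _ ≤ ‖convOp μ p‖ * ‖convOp μ p ^ n - expOp p‖ := norm_mul_le _ _
    _ ≤ 1 * ‖convOp μ p ^ n - expOp p‖ := by gcongr; exact norm_convOp_le p μ
    _ = _ := one_mul _

theorem tendsto_norm_convOp_pow_sub_expOp {μ : Measure Circle} [IsProbabilityMeasure μ]
    (h : ∃ k, 1 ≤ k ∧ NonSingular (convPow μ k)) :
    Tendsto (fun n : ℕ => ‖convOp μ p ^ n - expOp p‖) atTop (𝓝 0) := by
  obtain ⟨n, hn, c, hc, hle⟩ := exists_smul_leb_le_convPow h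
  obtain ⟨d, hd, ρ, hρ, heq⟩ := exists_eq_smul_leb_add hc hle
  have hmul : Tendsto (fun j : ℕ => n * j) atTop atTop :=
    tendsto_id.const_mul_atTop' hn
  refine (tendsto_iff_tendsto_subseq_of_antitone
    (antitone_norm_convOp_pow_sub_expOp p μ) hmul).2 ?_
  have hd1 : d.toReal < 1 := by
    simpa using (ENNReal.toReal_lt_toReal hd.ne_top ENNReal.one_ne_top).2 hd
  have hlim : Tendsto (fun j : ℕ => d.toReal ^ j * 2) atTop (𝓝 0) := by
    simpa using (tendsto_pow_atTop_nhds_zero_of_lt_one ENNReal.toReal_nonneg hd1).mul_const 2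
  refine squeeze_zero (fun _ => norm_nonneg _) (fun j => ?_) hlim
  have := norm_convOp_pow_sub_expOp_le p heq j
  rwa [← convOp_pow, ← pow_mul] at this

end

/-! ### Norm lower bounds for singular measures -/

section
variable (p : ℝ≥0∞) [hp : Fact (1 ≤ p)]

/-- On the indicator of `S`, P_ν takes at x the value ν(x⁻¹S), and E takes the value `leb S`. -/
lemma measure_preimage_mul_le_enorm_add (ν : Measure Circle) [IsProbabilityMeasure ν]
    {S : Set Circle} (hS : MeasurableSet S) :
    ∀ᵐ x ∂leb, ν ((fun y => x * y) ⁻¹' S) ≤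
      ‖(convOp ν p - expOp p) (indicatorConstLp p hS (measure_ne_top leb S) (1 : ℂ)) x‖ₑ
        + leb S := by
  set f := indicatorConstLp p hS (measure_ne_top leb S) (1 : ℂ)
  have hf : ⇑f =ᵐ[leb] S.indicator fun _ => (1 : ℂ) := indicatorConstLp_coeFn
  have hint : ∫ x, f x ∂leb = (leb.real S : ℂ) := by
    rw [integral_congr_ae hf, integral_indicator_const _ hS]
    simp
  filter_upwards [Lp.coeFn_sub (convOp ν p f) (expOp p f), convOp_coeFn ν p f, expOp_coeFn p f,
    ae_ae_mul (μ := ν) hf] with x h1 h2 h3 h4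
  have hm : MeasurableSet ((fun y => x * y) ⁻¹' S) := hS.preimage (by fun_prop)
  have h5 : ∫ y, f (x * y) ∂ν = (ν.real ((fun y => x * y) ⁻¹' S) : ℂ) := by
    rw [integral_congr_ae h4]
    have := integral_indicator_const (μ := ν) (1 : ℂ) hm
    simp only [Complex.real_smul, mul_one] at this
    exact this
  have h6 : ∀ (m : Measure Circle) [IsProbabilityMeasure m] (A : Set Circle),
      ‖(m.real A : ℂ)‖ₑ = m A := fun m _ A => by
    rw [← ofReal_norm, Complex.norm_real, Real.norm_of_nonneg measureReal_nonneg,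
      ofReal_measureReal]
  change _ ≤ ‖(convOp ν p f - expOp p f : Lp ℂ p leb) x‖ₑ + leb S
  rw [h1, Pi.sub_apply, h2, h3, h5, hint]
  calc ν ((fun y => x * y) ⁻¹' S)
      = ‖((ν.real ((fun y => x * y) ⁻¹' S) : ℂ) - leb.real S) + leb.real S‖ₑ := by
        rw [sub_add_cancel, h6]
    _ ≤ _ := by
        refine (enorm_add_le _ _).trans_eq ?_
        rw [h6 leb S]

/-- A compact K inside a null carrier of `ν` can have mass close to 1, and an open U around K can
have small Lebesgue measure. Pairs K ⊆ U leave room for small translations in the hypothesis. -/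
lemma one_le_of_mutuallySingular {ν : Measure Circle} [IsProbabilityMeasure ν]
    (h : ν ⟂ₘ leb) {c : ℝ≥0∞}
    (H : ∀ K U : Set Circle, IsCompact K → IsOpen U → K ⊆ U → ν K ≤ c + leb U) : 1 ≤ c := by
  have hA := h.measurableSet_nullSet.compl
  have h1 : ν h.nullSetᶜ = 1 :=
    (prob_compl_eq_one_iff h.measurableSet_nullSet).2 h.measure_nullSet
  rw [← h1, hA.measure_eq_iSup_isCompact]
  refine iSup₂_le fun K hK => iSup_le fun hKc => ?_
  have hK0 : leb K = 0 := measure_mono_null hK h.measure_compl_nullSet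
  refine ENNReal.le_of_forall_pos_le_add fun ε hε _ => ?_
  obtain ⟨U, hKU, hU, hlt⟩ := K.exists_isOpen_lt_of_lt (μ := leb) ε (by simpa [hK0] using hε)
  exact (H K U hKc hU hKU).trans (by gcongr)

/-- The indicator of U is the test function. The pointwise bound holds only for a.e. x, so x is
chosen in a neighbourhood V of 1 with VK ⊆ U, which has positive measure. -/
lemma measure_le_enorm_convOp_top_add (ν : Measure Circle) [IsProbabilityMeasure ν] {K U : Set Circle}
    (hK : IsCompact K) (hU : IsOpen U) (hKU : K ⊆ U) :
    ν K ≤ ‖convOp ν ∞ - expOp ∞‖ₑ + leb U := by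
  obtain ⟨V, hV, hVK⟩ := compact_open_separated_mul_left hK hU hKU
  set f := indicatorConstLp ∞ hU.measurableSet (measure_ne_top leb U) (1 : ℂ)
  have hf1 : ‖f‖ₑ ≤ 1 := by
    rw [Lp.enorm_def, eLpNorm_congr_ae indicatorConstLp_coeFn, eLpNorm_exponent_top]
    refine (eLpNormEssSup_indicator_const_le _ _).trans ?_
    simp
  have hle : ‖(convOp ν ∞ - expOp ∞) f‖ₑ ≤ ‖convOp ν ∞ - expOp ∞‖ₑ :=
    ((convOp ν ∞ - expOp ∞).le_opENorm f).trans (mul_le_of_le_one_right' hf1)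
  have hae : ∀ᵐ x ∂leb, ‖((convOp ν ∞ - expOp ∞) f) x‖ₑ ≤ ‖convOp ν ∞ - expOp ∞‖ₑ := by
    filter_upwards [ae_le_eLpNormEssSup (f := (convOp ν ∞ - expOp ∞) f) (μ := leb)] with x hx
    refine hx.trans (le_trans (le_of_eq ?_) hle)
    rw [Lp.enorm_def, eLpNorm_exponent_top]
  have hVpos : leb V ≠ 0 := (Measure.measure_pos_of_mem_nhds leb hV).ne'
  obtain ⟨x, hx, h1, h2⟩ := ((frequently_ae_mem_iff.2 hVpos).and_eventually
    (hae.and (measure_preimage_mul_le_enorm_add ∞ ν hU.measurableSet))).exists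
  calc ν K ≤ ν ((fun y => x * y) ⁻¹' U) :=
        measure_mono fun y hy => hVK (Set.mul_mem_mul hx hy)
    _ ≤ _ := h2.trans (by gcongr)

/-- The test function is the indicator of a small neighbourhood V of 1, of L_1 norm `leb V`. By
Fubini, P_ν sends mass at least ν(K) `leb V` into U⁻¹, whereas E puts only `leb V` times `leb U`
there; dividing by `leb V` gives the bound. -/
lemma measure_le_enorm_convOp_one_add (ν : Measure Circle) [IsProbabilityMeasure ν] {K U : Set Circle}
    (hK : IsCompact K) (hU : IsOpen U) (hKU : K ⊆ U) :
    ν K ≤ ‖convOp ν 1 - expOp 1‖ₑ + leb U := by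
  obtain ⟨V', hV', hVK⟩ := compact_open_separated_mul_left hK.inv hU.inv (Set.inv_subset_inv.2 hKU)
  obtain ⟨V, hVV', hVo, h1V⟩ := mem_nhds_iff.1 hV'
  set f := indicatorConstLp 1 hVo.measurableSet (measure_ne_top leb V) (1 : ℂ)
  have hf1 : ‖f‖ₑ = leb V := by
    rw [Lp.enorm_def, eLpNorm_congr_ae indicatorConstLp_coeFn,
      eLpNorm_indicator_const hVo.measurableSet one_ne_zero ENNReal.one_ne_top]
    simp
  have hle : ∫⁻ x, ‖((convOp ν 1 - expOp 1) f) x‖ₑ ∂leb ≤ ‖convOp ν 1 - expOp 1‖ₑ * leb V := by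
    rw [← eLpNorm_one_eq_lintegral_enorm, ← Lp.enorm_def, ← hf1]
    exact (convOp ν 1 - expOp 1).le_opENorm f
  have hVpos : leb V ≠ 0 := (hVo.measure_pos leb ⟨1, h1V⟩).ne'
  have hmul : ν K * leb V ≤ ∫⁻ x in U⁻¹, ν ((fun y => x * y) ⁻¹' V) ∂leb := by
    have hmeas : MeasurableSet {z : Circle × Circle | z.1 ∈ U⁻¹ ∧ z.1 * z.2 ∈ V} :=
      (hU.inv.measurableSet.preimage measurable_fst).inter
        (hVo.measurableSet.preimage (by fun_prop : Measurable fun z : Circle × Circle => z.1 * z.2))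
    have e1 : leb.prod ν {z : Circle × Circle | z.1 ∈ U⁻¹ ∧ z.1 * z.2 ∈ V} =
        ∫⁻ x in U⁻¹, ν ((fun y => x * y) ⁻¹' V) ∂leb := by
      rw [Measure.prod_apply hmeas, ← lintegral_indicator hU.inv.measurableSet]
      refine lintegral_congr fun x => ?_
      by_cases hx : x ∈ U⁻¹
      · rw [Set.indicator_of_mem hx]
        congr 1
        ext y
        exact and_iff_right hx
      · rw [Set.indicator_of_notMem hx]
        refine (congrArg ν ?_).trans measure_empty
        ext y
        exact iff_of_false (fun h => hx h.1) (Set.notMem_empty y)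
    rw [← e1, Measure.prod_apply_symm hmeas, mul_comm, ← setLIntegral_const,
      ← lintegral_indicator hK.measurableSet]
    refine lintegral_mono fun y => ?_
    by_cases hy : y ∈ K
    · rw [Set.indicator_of_mem hy, ← measure_preimage_mul_right leb y V]
      refine measure_mono fun x hx => ⟨?_, hx⟩
      -- If xy is in V and y is in K, then x = (xy)y⁻¹ lies in VK⁻¹, hence in U⁻¹.
      have := hVK (Set.mul_mem_mul (hVV' hx) (Set.inv_mem_inv.2 hy))
      simpa using this
    · rw [Set.indicator_of_notMem hy]
      exact zero_le
  have hsum : ν K * leb V ≤ (‖convOp ν 1 - expOp 1‖ₑ + leb U) * leb V :=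
    calc ν K * leb V
        ≤ ∫⁻ x in U⁻¹, (‖((convOp ν 1 - expOp 1) f) x‖ₑ + leb V) ∂leb :=
          hmul.trans (lintegral_mono_ae (ae_restrict_of_ae
            (measure_preimage_mul_le_enorm_add 1 ν hVo.measurableSet)))
      _ = ∫⁻ x in U⁻¹, ‖((convOp ν 1 - expOp 1) f) x‖ₑ ∂leb + leb V * leb U := by
          rw [lintegral_add_right _ measurable_const, setLIntegral_const, Measure.measure_inv]
      _ ≤ ‖convOp ν 1 - expOp 1‖ₑ * leb V + leb V * leb U := by
          gcongr
          exact (setLIntegral_le_lintegral _ _).trans hle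
      _ = _ := by ring
  exact (ENNReal.mul_le_mul_iff_left hVpos (measure_ne_top _ _)).1 hsum

end

/-! ### The equivalences -/

lemma exists_nonSingular_of_tendsto (p : ℝ≥0∞) [Fact (1 ≤ p)] {μ : Measure Circle}
    [IsProbabilityMeasure μ]
    (H : ∀ (ν : Measure Circle) [IsProbabilityMeasure ν] (K U : Set Circle), IsCompact K →
      IsOpen U → K ⊆ U → ν K ≤ ‖convOp ν p - expOp p‖ₑ + leb U)
    (h : Tendsto (fun n : ℕ => ‖convOp μ p ^ n - expOp p‖) atTop (𝓝 0)) :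
    ∃ k, 1 ≤ k ∧ NonSingular (convPow μ k) := by
  -- A single n ≥ 1 with norm below 1 already excludes singularity of `μ^n`.
  obtain ⟨n, hn, hn1⟩ := ((h.eventually_lt_const one_pos).and (eventually_ge_atTop 1)).exists
  refine ⟨n, hn1, fun hs => ?_⟩
  rw [convOp_pow] at hn
  have h1 := one_le_of_mutuallySingular hs (H (convPow μ n))
  rw [← ofReal_norm, ENNReal.one_le_ofReal] at h1
  exact hn.not_ge h1

lemma doeblin_iff_tendsto_top (μ : Measure Circle) [IsProbabilityMeasure μ] :
    Doeblin (walkKernel μ) leb ↔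
      Tendsto (fun n : ℕ => ‖convOp μ ∞ ^ n - expOp ∞‖) atTop (𝓝 0) :=
  (doeblin_iff_exists_nonSingular μ).trans ⟨tendsto_norm_convOp_pow_sub_expOp ∞,
    exists_nonSingular_of_tendsto ∞ fun ν _ _ _ => measure_le_enorm_convOp_top_add ν⟩

lemma doeblin_iff_tendsto_one (μ : Measure Circle) [IsProbabilityMeasure μ] :
    Doeblin (walkKernel μ) leb ↔
      Tendsto (fun n : ℕ => ‖convOp μ 1 ^ n - expOp 1‖) atTop (𝓝 0) :=
  (doeblin_iff_exists_nonSingular μ).trans ⟨tendsto_norm_convOp_pow_sub_expOp 1,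
    exists_nonSingular_of_tendsto 1 fun ν _ _ _ => measure_le_enorm_convOp_one_add ν⟩

lemma doeblin_iff_doeblin_reflect (μ : Measure Circle) [IsProbabilityMeasure μ] :
    Doeblin (walkKernel μ) leb ↔ Doeblin (walkKernel (reflect μ)) leb := by
  rw [doeblin_iff_exists_nonSingular, doeblin_iff_exists_nonSingular]
  refine ⟨exists_nonSingular_reflect, fun ⟨k, hk, h⟩ => ⟨k, hk, ?_⟩⟩
  rw [convPow_reflect] at h
  simpa only [reflect_reflect] using nonSingular_reflect h

end CircleWalk

theorem mainTheorem1 (μ : Measure Circle) [IsProbabilityMeasure μ]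
    (hμ : CircleWalk.Adapted μ) :
    -- (i)
    (CircleWalk.Doeblin (CircleWalk.walkKernel μ) CircleWalk.leb ↔
      ∃ k : ℕ, 1 ≤ k ∧ CircleWalk.NonSingular (CircleWalk.convPow μ k)) ∧
    -- (ii)
    (CircleWalk.Doeblin (CircleWalk.walkKernel μ) CircleWalk.leb ↔
      CircleWalk.Doeblin (CircleWalk.walkKernel (CircleWalk.reflect μ)) CircleWalk.leb) ∧
    (Tendsto (fun n : ℕ => ‖CircleWalk.convOp μ ∞ ^ n - CircleWalk.expOp ∞‖) atTop (𝓝 0) ↔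
      Tendsto (fun n : ℕ => ‖CircleWalk.convOp μ 1 ^ n - CircleWalk.expOp 1‖) atTop (𝓝 0)) ∧
    -- the two forms of (ii) say the same
    (CircleWalk.Doeblin (CircleWalk.walkKernel μ) CircleWalk.leb ↔
      Tendsto (fun n : ℕ => ‖CircleWalk.convOp μ ∞ ^ n - CircleWalk.expOp ∞‖) atTop (𝓝 0)) ∧
    (CircleWalk.Doeblin (CircleWalk.walkKernel (CircleWalk.reflect μ)) CircleWalk.leb ↔
      Tendsto (fun n : ℕ => ‖CircleWalk.convOp μ 1 ^ n - CircleWalk.expOp 1‖) atTop (𝓝 0)) :=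
  ⟨CircleWalk.doeblin_iff_exists_nonSingular μ, CircleWalk.doeblin_iff_doeblin_reflect μ,
    (CircleWalk.doeblin_iff_tendsto_top μ).symm.trans (CircleWalk.doeblin_iff_tendsto_one μ),
    CircleWalk.doeblin_iff_tendsto_top μ,
    (CircleWalk.doeblin_iff_doeblin_reflect μ).symm.trans (CircleWalk.doeblin_iff_tendsto_one μ)⟩
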